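/- Write $\mathbb N=\{0,1,2,\dots\}$, let $\operatorname{Sym}(A)$ be the group of all permutations of a set $A$, and let $\binom{\mathbb N}{k}$ be the set of $k$-element subsets of $\mathbb N$. A permutation group $G$ on a set $A$ is *primitive* if it is transitive and the only equivalence relations on $A$ preserved by $G$ are the equality relation and $A^2$. Permutation groups $G$ on $A$ and $H$ on $B$ are *isomorphic as permutation groups* if there are a bijection $e\colon A\to B$ and a group isomorphism $\varphi\colon G\to H$ such that $e(g(a))=\varphi(g)(e(a))$ for all $g\in G$ and $a\in A$. For $k\in\mathbb N$, the *Johnson graph* $\mathfrak J(k)$ has vertex set $\binom{\mathbb N}{k}$, and $S,T$ are adjacent if and only if $|S\cap T|=k-1$ (so $\mathfrak J(0)$ is a single vertex without edges). A *first-order reduct* of a structure $\mathfrak A$ is a structure with the same domain all of whose relations (and the graphs of all of whose operations, if its signature has function symbols) are definable in $\mathfrak A$ by first-order formulas without parameters. (1) Let $\xi\colon\operatorname{Sym}(\mathbb N)\to\operatorname{Sym}(\mathbb N)$ be a group homomorphism whose image $G=\xi(\operatorname{Sym}(\mathbb N))$ is a primitive permutation group on $\mathbb N$. Then there exists $k\in\mathbb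 N$ such that $G$ is isomorphic, as a permutation group, to the permutation group on $\binom{\mathbb N}{k}$ given by the setwise action $\sigma\cdot S=\{\sigma(s)\mid s\in S\}$ of $\operatorname{Sym}(\mathbb N)$. (2) Let $\mathfrak B$ be a structure, in an arbitrary signature, with a nonempty, at most countable domain $B$, which is preserved by a primitive action of $\operatorname{Sym}(\mathbb N)$, i.e. there is a group homomorphism $\xi\colon\operatorname{Sym}(\mathbb N)\to\operatorname{Sym}(B)$ whose image is a primitive permutation group on $B$ and consists of automorphisms of $\mathfrak B$. Then there exists $k\in\mathbb N$ such that $\mathfrak B$ is isomorphic to a first-order reduct of $\mathfrak J(k)$. -/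

import Mathlib

universe u v w

/-- Two permutation groups `G` on `A` and `H` on `B` are isomorphic as permutation groups: there are
a bijection `e : A ≃ B` and a group isomorphism `φ : G ≃* H` such that `e (g a) = φ(g) (e a)`. -/
def IsIsomorphicPermGroup {A B : Type*} (G : Subgroup (Equiv.Perm A))
    (H : Subgroup (Equiv.Perm B)) : Prop :=
  ∃ (e : A ≃ B) (φ : G ≃* H), ∀ (g : G) (a : A),
    e ((g : Equiv.Perm A) a) = (φ g : Equiv.Perm B) (e a)

/-- The permutation group on the set of `k`-element subsets of `ℕ` that is given by the setwise
action `σ • S = {σ s | s ∈ S}` of `Sym(ℕ)`. -/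
def setwiseSymGroup (k : ℕ) : Subgroup (Equiv.Perm (Set.powersetCard ℕ k)) :=
  (MulAction.toPermHom (Equiv.Perm ℕ) (Set.powersetCard ℕ k)).range

/-- The Johnson graph: its vertices are the `k`-element subsets of `ℕ`, and `S`, `T` are adjacent if
and only if `|S ∩ T| = k - 1` (an equation in `ℤ`, so that there is no edge for `k = 0`). -/
def johnsonGraph (k : ℕ) : SimpleGraph (Set.powersetCard ℕ k) where
  Adj S T := ((S : Finset ℕ) ∩ (T : Finset ℕ)).card + 1 = k
  symm := ⟨fun S T h => by rwa [Finset.inter_comm]⟩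
  loopless := ⟨fun S h => by simp at h⟩

/-- The Johnson graph as a first-order structure, whose only symbol is the edge relation. -/
instance johnsonStructure (k : ℕ) : FirstOrder.Language.graph.Structure (Set.powersetCard ℕ k) :=
  (johnsonGraph k).structure

/-- The `L`-structure on `M` is a first-order reduct of the `L'`-structure on the same set `M`: every
relation of the former, and the graph of every operation of the former if there are any, is definable
in the latter by a first-order formula without parameters. -/
def IsFirstOrderReduct (L L' : FirstOrder.Language) (M : Type*) [L.Structure M] [L'.Structure M] :
    Prop :=
  (∀ (n : ℕ) (R : L.Relations n),
    (∅ : Set M).Definable L' {x : Fin n → M | FirstOrder.Language.Structure.RelMap R x}) ∧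
  (∀ (n : ℕ) (f : L.Functions n),
    (∅ : Set M).Definable L' {x : Fin (n + 1) → M |
      FirstOrder.Language.Structure.funMap f (fun i : Fin n => x i.castSucc) = x (Fin.last n)})

/-- The `L`-structure on `B` is preserved by a primitive action of `Sym(ℕ)`: there is an action of
`Sym(ℕ)` on `B` by automorphisms of the structure, whose image is a primitive permutation group. -/
def PreservedByPrimitiveActionOfSym (L : FirstOrder.Language) (B : Type*) [L.Structure B] : Prop :=
  ∃ ξ : Equiv.Perm ℕ →* Equiv.Perm B,
    MulAction.IsPreprimitive ξ.range B ∧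
    ∀ σ : Equiv.Perm ℕ, ∃ f : L.Equiv B B, ∀ b : B, f b = ξ σ b

/-! The stabilizer of a point in a transitive action on a countable set has countable index in
`Sym(ℕ)`. By the small index property (`exists_finset_containsPermsOn_compl`) such a subgroup
contains the pointwise stabilizer of a finite set `F`, and for `F` of least size it also preserves
`F`. So the point stabilizer lies in the setwise stabilizer of `F`. Primitivity makes point
stabilizers maximal, which forces equality, and the action is that on `k`-sets with `k = |F|`. This
gives (1).

For (2), transport the structure to the `k`-subsets, where all its relations and operations become
invariant under `Sym(ℕ)`. Every automorphism of the Johnson graph comes from `Sym(ℕ)`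
(`exists_perm_of_johnsonGraph_automorphism`), and there are finitely many orbits of `n`-tuples for
each `n`. The Ryll-Nardzewski argument (`FinitelyManyOrbits.definable_of_invariant`) then makes
every invariant relation definable in the graph. -/

open Equiv in
/-- The subgroup `H` contains every permutation whose support is contained in `S`. -/
def ContainsPermsOn {Ω : Type*} (H : Subgroup (Perm Ω)) (S : Set Ω) : Prop :=
  ∀ g : Perm Ω, (∀ x ∉ S, g x = x) → g ∈ H

/-! ### Subgroups of countable index: diagonalisation over cosets and commutators. -/

section SmallIndex

open Equiv

variable {Ω : Type*}

theorem perm_apply_mem_of_fixes_compl {S : Set Ω} {g : Perm Ω} (hg : ∀ x ∉ S, g x = x) {x : Ω}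
    (hx : x ∈ S) : g x ∈ S := by
  by_contra h
  have := g.injective (hg _ h)
  exact h (this.symm ▸ hx)

theorem perm_inv_fixes_compl {S : Set Ω} {g : Perm Ω} (hg : ∀ x ∉ S, g x = x) :
    ∀ x ∉ S, g⁻¹ x = x := fun x hx => by
  rw [Perm.inv_eq_iff_eq, hg x hx]

theorem ContainsPermsOn.mono {H : Subgroup (Perm Ω)} {S T : Set Ω} (h : ContainsPermsOn H T)
    (hST : S ⊆ T) : ContainsPermsOn H S :=
  fun g hg => h g fun x hx => hg x fun hxS => hx (hST hxS)

theorem ContainsPermsOn.image {H : Subgroup (Perm Ω)} {S : Set Ω} (h : ContainsPermsOn H S)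
    {k : Perm Ω} (hk : k ∈ H) : ContainsPermsOn H (k '' S) := by
  intro g hg
  have h1 : k⁻¹ * g * k ∈ H := by
    refine h _ fun x hx => ?_
    have : g (k x) = k x := hg _ fun ⟨y, hy, hyx⟩ => hx (k.injective hyx ▸ hy)
    simp [this]
  have h2 := H.mul_mem (H.mul_mem hk h1) (H.inv_mem hk)
  simpa [mul_assoc] using h2

theorem exists_perm_glue (c : Ω → Option ℕ) (τ : ℕ → Perm Ω)
    (hτ : ∀ i x, c x ≠ some i → τ i x = x) :
    ∃ σ : Perm Ω, (∀ x, c x = none → σ x = x) ∧ ∀ i x, c x = some i → σ x = τ i x := by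
  have key : ∀ i x, c x = some i → c (τ i x) = some i := fun i x hx =>
    perm_apply_mem_of_fixes_compl (S := {x | c x = some i}) (hτ i) hx
  have hτ' : ∀ i x, c x ≠ some i → (τ i)⁻¹ x = x := fun i =>
    perm_inv_fixes_compl (S := {x | c x = some i}) (hτ i)
  have key' : ∀ i x, c x = some i → c ((τ i)⁻¹ x) = some i := fun i x hx =>
    perm_apply_mem_of_fixes_compl (S := {x | c x = some i}) (hτ' i) hx
  let f (ρ : ℕ → Perm Ω) (x : Ω) : Ω := (c x).elim x fun i => ρ i x
  have f_none : ∀ ρ x, c x = none → f ρ x = x := fun ρ x h => by simp [f, h]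
  have f_some : ∀ ρ i x, c x = some i → f ρ x = ρ i x := fun ρ i x h => by simp [f, h]
  refine ⟨⟨f τ, f fun i => (τ i)⁻¹, fun x => ?_, fun x => ?_⟩, f_none τ, f_some τ⟩
  · rcases h : c x with _ | i
    · rw [f_none τ x h, f_none _ x h]
    · rw [f_some τ i x h, f_some _ i _ (key i x h)]; simp
  · rcases h : c x with _ | i
    · rw [f_none _ x h, f_none _ x h]
    · rw [f_some _ i x h, f_some _ i _ (key' i x h)]; simp

/-- A subgroup of countable index induces the full symmetric group on one piece of any countable
partition, even by permutations that fix all points outside the pieces. -/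
theorem exists_piece_forall_perm_induced (H : Subgroup (Perm Ω)) [Countable (Perm Ω ⧸ H)]
    (c : Ω → Option ℕ) :
    ∃ i, ∀ π : Perm Ω, (∀ x, c x ≠ some i → π x = x) →
      ∃ h ∈ H, (∀ x, c x = none → h x = x) ∧ ∀ x, c x = some i → h x = π x := by
  by_contra! hcon
  choose π hπ hbad using hcon
  obtain ⟨q, hq⟩ := exists_surjective_nat (Perm Ω ⧸ H)
  choose r hr using fun i => QuotientGroup.mk_surjective (q i)
  -- Diagonalisation: no element of the coset `r i * H` that fixes the uncoloured points may agree
  -- with `τ` on piece `i`. If the coset induces some `τ` there, it cannot also induce `τ * π i`,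
  -- since the quotient of the two elements would lie in `H` and induce `π i`. The permutation glued
  -- from these choices then lies in no coset.
  have step : ∀ i, ∃ τ : Perm Ω, (∀ x, c x ≠ some i → τ x = x) ∧
      ∀ g : Perm Ω, (r i)⁻¹ * g ∈ H → (∀ x, c x = none → g x = x) →
        ∃ x, c x = some i ∧ g x ≠ τ x := by
    intro i
    by_cases hex : ∃ (τ : Perm Ω) (g : Perm Ω), (∀ x, c x ≠ some i → τ x = x) ∧
        (r i)⁻¹ * g ∈ H ∧ (∀ x, c x = none → g x = x) ∧ ∀ x, c x = some i → g x = τ x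
    · obtain ⟨τ, g₀, hτ, hg₀, hn₀, ha₀⟩ := hex
      refine ⟨τ * π i, fun x hx => by rw [Perm.mul_apply, hπ i x hx, hτ x hx],
        fun g hg hn => ?_⟩
      have hmem : g₀⁻¹ * g ∈ H := by
        have := H.mul_mem (H.inv_mem hg₀) hg
        simpa [mul_assoc] using this
      obtain ⟨x, hx, hne⟩ := hbad i _ hmem fun x hx => by
        rw [Perm.mul_apply, hn x hx, Perm.inv_eq_iff_eq, hn₀ x hx]
      refine ⟨x, hx, fun h => hne ?_⟩
      have hπx : c (π i x) = some i :=
        perm_apply_mem_of_fixes_compl (S := {x | c x = some i}) (hπ i) hx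
      rw [Perm.mul_apply, Perm.inv_eq_iff_eq, ha₀ _ hπx, h, Perm.mul_apply]
    · push Not at hex
      exact ⟨1, fun _ _ => rfl, fun g hg hn => hex 1 g (fun _ _ => rfl) hg hn⟩
  choose τ hτ hτbad using step
  obtain ⟨σ, hσn, hσ⟩ := exists_perm_glue c τ hτ
  obtain ⟨i, hi⟩ := hq (QuotientGroup.mk σ)
  have : (r i)⁻¹ * σ ∈ H := by rw [← QuotientGroup.eq, hr, hi]
  obtain ⟨x, hx, hne⟩ := hτbad i σ this hσn
  exact hne (hσ i x hx)

/-- If `H` induces `a` on `S` and, by a permutation with support in `S`, also `b` on `T ⊆ S`, then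
`H` contains the commutator of `a` and `b`. -/
theorem commutator_mem_of_induced {H : Subgroup (Perm Ω)} {S T : Set Ω} (hTS : T ⊆ S)
    {a b g h : Perm Ω} (ha : ∀ x ∉ T, a x = x) (hb : ∀ x ∉ T, b x = x) (hg : g ∈ H) (hh : h ∈ H)
    (hga : ∀ x ∈ S, g x = a x) (hhS : ∀ x ∉ S, h x = x) (hhb : ∀ x ∈ T, h x = b x) :
    a * b * a⁻¹ * b⁻¹ ∈ H := by
  -- `a⁻¹ * g` fixes `S` pointwise and `b⁻¹ * h` moves only points of `S \ T`. So the former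
  -- commutes with `h` and the latter with `a`, whence `[g, h] = [a, h] = [a, b]`.
  have hu : ∀ x ∈ S, (a⁻¹ * g) x = x := fun x hx => by
    rw [Perm.mul_apply, Perm.inv_eq_iff_eq, hga x hx]
  have hv : ∀ x ∈ T, (b⁻¹ * h) x = x := fun x hx => by
    rw [Perm.mul_apply, Perm.inv_eq_iff_eq, hhb x hx]
  have hv' : ∀ x ∉ S, (b⁻¹ * h) x = x := fun x hx => by
    rw [Perm.mul_apply, Perm.inv_eq_iff_eq, hhS x hx, hb x fun h => hx (hTS h)]
  have hub : Commute (a⁻¹ * g) b := Perm.Disjoint.commute fun x => by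
    by_cases hx : x ∈ S
    · exact .inl (hu x hx)
    · exact .inr (hb x fun h => hx (hTS h))
  have huv : Commute (a⁻¹ * g) (b⁻¹ * h) := Perm.Disjoint.commute fun x => by
    by_cases hx : x ∈ S
    · exact .inl (hu x hx)
    · exact .inr (hv' x hx)
  have hva : Commute (b⁻¹ * h) a := Perm.Disjoint.commute fun x => by
    by_cases hx : x ∈ T
    · exact .inl (hv x hx)
    · exact .inr (ha x hx)
  have huh : Commute (a⁻¹ * g) h := by
    have := hub.mul_right huv
    rwa [mul_inv_cancel_left] at this
  have e1 : g * h * g⁻¹ = a * h * a⁻¹ := by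
    have h1 := huh.eq
    have h2 : g * h = a * h * (a⁻¹ * g) := by
      rw [mul_assoc a h, ← h1]; group
    rw [h2]; group
  have e2 : a * h * a⁻¹ * h⁻¹ = a * b * a⁻¹ * b⁻¹ := by
    have h2 : h * a⁻¹ = b * a⁻¹ * (b⁻¹ * h) := by
      rw [mul_assoc b, ← (hva.inv_right).eq]; group
    rw [mul_assoc a h, h2]; group
  rw [← e2, ← e1]
  exact H.mul_mem (H.mul_mem (H.mul_mem hg hh) (H.inv_mem hg)) (H.inv_mem hh)

end SmallIndex

/-! ### From one large symmetric subgroup to the small index property. -/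

section Moieties

open Equiv

variable {Ω : Type*}

/-- A permutation supported in one of infinitely many copies of `ℕ` inside `T` is a commutator of
permutations supported in `T`. -/
theorem exists_commutator_eq {T : Set Ω} (f : ℤ × ℕ ≃ T) {g : Perm Ω}
    (hg : ∀ x ∉ Set.range (fun n : ℕ => (f (0, n) : Ω)), g x = x) :
    ∃ a b : Perm Ω, (∀ x ∉ T, a x = x) ∧ (∀ x ∉ T, b x = x) ∧ a * b * a⁻¹ * b⁻¹ = g := by
  classical
  let ε := Equiv.ofInjective (fun n : ℕ => (f (0, n) : Ω)) fun m n h => by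
    simpa using f.injective (Subtype.ext h)
  have hmem : ∀ x, g x ∈ Set.range (fun n : ℕ => (f (0, n) : Ω)) ↔
      x ∈ Set.range (fun n : ℕ => (f (0, n) : Ω)) := fun x =>
    ⟨fun h => by
      have := perm_apply_mem_of_fixes_compl (perm_inv_fixes_compl hg) h
      simpa using this, perm_apply_mem_of_fixes_compl hg⟩
  let γ : Perm ℕ := ε.symm.permCongr (g.subtypePerm hmem)
  have hγ : ∀ n, g (f (0, n)) = f (0, γ n) := fun n => by
    have : ε (γ n) = g.subtypePerm hmem (ε n) := by simp [γ]
    exact (congrArg Subtype.val this).symm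
  -- `A` acts as `γ` on every copy with index `≥ 0` and `B` shifts the copies by one. Then `B * A⁻¹
  -- * B⁻¹` acts as `γ⁻¹` on the copies with index `≥ 1`, and the commutator keeps only `γ` on copy
  -- `0`.
  let A : Perm (ℤ × ℕ) :=
    { toFun := fun x => (x.1, if 0 ≤ x.1 then γ x.2 else x.2)
      invFun := fun x => (x.1, if 0 ≤ x.1 then γ⁻¹ x.2 else x.2)
      left_inv := fun x => by by_cases h : 0 ≤ x.1 <;> simp [h]
      right_inv := fun x => by by_cases h : 0 ≤ x.1 <;> simp [h] }
  let B : Perm (ℤ × ℕ) := (Equiv.addRight (1 : ℤ)).prodCongr (Equiv.refl ℕ)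
  have hA : ∀ m n, A⁻¹ (m, n) = (m, if 0 ≤ m then γ⁻¹ n else n) := fun _ _ => rfl
  have hB : ∀ m n, B⁻¹ (m, n) = (m - 1, n) := fun m n => by
    rw [Perm.inv_eq_iff_eq]; simp [B]
  have hAB : ∀ m n, (A * B * A⁻¹ * B⁻¹) (m, n) = (m, if m = 0 then γ n else n) := fun m n => by
    rw [Perm.mul_apply, Perm.mul_apply, Perm.mul_apply, hB, hA]
    rcases lt_trichotomy m 0 with h | h | h
    · have h1 : ¬ (0 ≤ m - 1) := by lia
      have h2 : ¬ (0 ≤ m) := by lia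
      simp [A, B, h.ne]; lia
    · subst h; simp [A, B]
    · have h1 : 0 ≤ m - 1 := by lia
      have h2 : 0 ≤ m := by lia
      rw [if_pos h1]
      simp [A, B, h.ne']
      lia
  refine ⟨A.extendDomain f, B.extendDomain f, fun x hx => A.extendDomain_apply_not_subtype f hx,
    fun x hx => B.extendDomain_apply_not_subtype f hx, ?_⟩
  rw [Perm.extendDomain_inv, Perm.extendDomain_inv, Perm.extendDomain_mul,
    Perm.extendDomain_mul, Perm.extendDomain_mul]
  ext x
  by_cases hx : x ∈ T
  · obtain ⟨⟨m, n⟩, hmn⟩ := f.surjective ⟨x, hx⟩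
    obtain rfl : (f (m, n) : Ω) = x := congrArg Subtype.val hmn
    rw [Perm.extendDomain_apply_image, hAB]
    by_cases h0 : m = 0
    · subst h0; simp [hγ]
    · rw [if_neg h0, hg]
      rintro ⟨k, hk⟩
      have := f.injective (Subtype.ext hk)
      exact h0 (congrArg Prod.fst this).symm
  · rw [Perm.extendDomain_apply_not_subtype _ _ hx, hg]
    rintro ⟨k, rfl⟩
    exact hx (f _).2

/-- A subgroup of countable index contains all permutations supported in some infinite set with
infinite complement. -/
theorem exists_infinite_containsPermsOn [Countable Ω] [Infinite Ω] (H : Subgroup (Perm Ω))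
    [Countable (Perm Ω ⧸ H)] : ∃ S : Set Ω, S.Infinite ∧ Sᶜ.Infinite ∧ ContainsPermsOn H S := by
  obtain ⟨e⟩ := nonempty_equiv_of_countable (α := Ω) (β := ℕ × ℕ × ℤ × ℕ)
  obtain ⟨i, hi⟩ := exists_piece_forall_perm_induced H fun x => some (e x).1
  -- Only piece `i` is split further; all other points get `none`. The elements of `H` obtained here
  -- therefore fix everything outside piece `i`, as `commutator_mem_of_induced` demands of `h`.
  obtain ⟨j, hj⟩ := exists_piece_forall_perm_induced H
    fun x => if (e x).1 = i then some (e x).2.1 else none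
  let T : Set Ω := {x | (e x).1 = i ∧ (e x).2.1 = j}
  let f : ℤ × ℕ ≃ T :=
    { toFun := fun x => ⟨e.symm (i, j, x), by simp [T]⟩
      invFun := fun x => (e x).2.2
      left_inv := fun x => by simp
      right_inv := fun ⟨x, hx⟩ => by
        simp only [Subtype.mk.injEq]
        rw [Equiv.symm_apply_eq, ← hx.1, ← hx.2] }
  have hf : ∀ m, Function.Injective fun n : ℕ => (f (m, n) : Ω) := fun m a b h => by
    simpa using f.injective (Subtype.ext h)
  refine ⟨Set.range fun n : ℕ => (f (0, n) : Ω), Set.infinite_range_of_injective (hf 0),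
    (Set.infinite_range_of_injective (hf 1)).mono ?_, fun g hg => ?_⟩
  · rintro _ ⟨n, rfl⟩ ⟨k, hk⟩
    have := f.injective (Subtype.ext hk)
    simp at this
  · obtain ⟨a, b, ha, hb, rfl⟩ := exists_commutator_eq f hg
    obtain ⟨p, hp, -, hpa⟩ := hi a fun x hx => ha x fun h => hx (by simp [h.1])
    obtain ⟨q, hq, hqS, hqb⟩ := hj b fun x hx => hb x fun h => hx (by simp [h.1, h.2])
    refine commutator_mem_of_induced (S := {x | (e x).1 = i}) (fun x hx => hx.1) ha hb hp hq
      (fun x hx => hpa x (by simpa using hx)) (fun x hx => hqS x ?_) fun x hx => hqb x ?_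
    · simpa using hx
    · simp [hx.1, hx.2]

/-- `f` on `A` together with the identity off `S` is an injective partial map. The points missing
from its domain and from its range form countably infinite sets, so any bijection between these
completes it. -/
theorem exists_perm_extending [Countable Ω] {S A : Set Ω} (hAS : A ⊆ S) {f : Ω → Ω}
    (hf : Set.InjOn f A) (hfS : Set.MapsTo f A S) (h₁ : (S \ A).Infinite)
    (h₂ : (S \ f '' A).Infinite) :
    ∃ g : Perm Ω, (∀ x ∉ S, g x = x) ∧ ∀ x ∈ A, g x = f x := by
  classical
  let F : Ω → Ω := fun x => if x ∈ A then f x else x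
  have FA : ∀ x ∈ A, F x = f x := fun x hx => if_pos hx
  have FS : ∀ x ∉ S, F x = x := fun x hx => if_neg fun h => hx (hAS h)
  have hF : Set.BijOn F (A ∪ Sᶜ) (f '' A ∪ Sᶜ) := by
    refine ⟨?_, ?_, ?_⟩
    · rintro x (hx | hx)
      · rw [FA x hx]; exact .inl ⟨x, hx, rfl⟩
      · rw [FS x hx]; exact .inr hx
    · rintro x (hx | hx) y (hy | hy) h
      · rw [FA x hx, FA y hy] at h; exact hf hx hy h
      · rw [FA x hx, FS y hy] at h; exact absurd (h ▸ hfS hx) hy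
      · rw [FS x hx, FA y hy] at h; exact absurd (h ▸ hfS hy) hx
      · rwa [FS x hx, FS y hy] at h
    · rintro _ (⟨x, hx, rfl⟩ | hx)
      · exact ⟨x, .inl hx, FA x hx⟩
      · exact ⟨_, .inr hx, FS _ hx⟩
  have c₁ : Infinite ↑((A ∪ Sᶜ)ᶜ) := (h₁.mono fun x hx h => h.elim hx.2 fun h => h hx.1).to_subtype
  have c₂ : Infinite ↑((f '' A ∪ Sᶜ)ᶜ) :=
    (h₂.mono fun x hx h => h.elim hx.2 fun h => h hx.1).to_subtype
  obtain ⟨e₂⟩ := nonempty_equiv_of_countable (α := ↑((A ∪ Sᶜ)ᶜ)) (β := ↑((f '' A ∪ Sᶜ)ᶜ))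
  let g : Perm Ω := (Equiv.Set.sumCompl (A ∪ Sᶜ)).symm.trans
    ((Equiv.sumCongr (hF.equiv F) e₂).trans (Equiv.Set.sumCompl (f '' A ∪ Sᶜ)))
  have hg : ∀ x ∈ A ∪ Sᶜ, g x = F x := fun x hx => by
    simp only [g, Equiv.trans_apply]
    rw [Equiv.Set.sumCompl_symm_apply_of_mem hx]
    rfl
  exact ⟨g, fun x hx => (hg x (.inr hx)).trans (FS x hx),
    fun x hx => (hg x (.inl hx)).trans (FA x hx)⟩

theorem exists_perm_image_subset [Countable Ω] {S A I : Set Ω} (hAS : A ⊆ S) (hIS : I ⊆ S)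
    (hI : I.Infinite) (hSA : (S \ A).Infinite) :
    ∃ g : Perm Ω, (∀ x ∉ S, g x = x) ∧ g '' A ⊆ I ∧ (I \ g '' A).Infinite := by
  have := hI.to_subtype
  obtain ⟨φ⟩ := nonempty_equiv_of_countable (α := ℕ) (β := I)
  obtain ⟨ε, hε⟩ := Countable.exists_injective_nat Ω
  have hinj : Function.Injective fun n => (φ n : Ω) := Subtype.val_injective.comp φ.injective
  -- Values are taken only among the even-indexed elements of `I`, which leaves the odd-indexed ones
  -- free.
  let f : Ω → Ω := fun x => φ (2 * ε x)
  have hinf : (I \ f '' A).Infinite := by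
    refine (Set.infinite_range_of_injective (f := fun n => (φ (2 * n + 1) : Ω))
      fun m n h => ?_).mono ?_
    · have := hinj h; lia
    · rintro _ ⟨n, rfl⟩
      refine ⟨(φ _).2, ?_⟩
      rintro ⟨x, -, hx⟩
      have := hinj hx
      lia
  obtain ⟨g, hg, hgf⟩ := exists_perm_extending (f := f) hAS
    (fun x _ y _ h => hε (by have := hinj h; lia)) (fun x _ => hIS (φ _).2) hSA
    (hinf.mono (Set.sdiff_subset_sdiff_left hIS))
  rw [← Set.image_congr hgf] at hinf
  refine ⟨g, hg, ?_, hinf⟩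
  rintro _ ⟨x, hx, rfl⟩
  rw [hgf x hx]
  exact (φ _).2

/-- A permutation `u` of `S ∪ T` is reduced to one supported in `S`. If `u` leaves enough room in
`S`, some `s` on `S` pushes `S ∩ u '' (T \ S)` into `S ∩ T`. Now `s * u` maps `T \ S` into `T`, some
`t` on `T` undoes it there, and `t * s * u` fixes `T \ S`. -/
theorem ContainsPermsOn.union [Countable Ω] {H : Subgroup (Perm Ω)} {S T : Set Ω}
    (hS : ContainsPermsOn H S) (hT : ContainsPermsOn H T) (hI : (S ∩ T).Infinite) :
    ContainsPermsOn H (S ∪ T) := by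
  have mem_of_fix : ∀ u : Perm Ω, (∀ x ∉ S ∪ T, u x = x) → (∀ x ∈ T \ S, u x = x) → u ∈ H :=
    fun u hu hu' => hS u fun x hx => by
      by_cases hxT : x ∈ T
      · exact hu' x ⟨hxT, hx⟩
      · exact hu x fun h => h.elim hx hxT
  have key : ∀ u : Perm Ω, (∀ x ∉ S ∪ T, u x = x) → (S \ u '' (T \ S)).Infinite → u ∈ H := by
    intro u hu hinf
    obtain ⟨s, hs, hsI, hsinf⟩ := exists_perm_image_subset (A := S ∩ u '' (T \ S))
      Set.inter_subset_left (Set.inter_subset_left (t := T)) hI (by rwa [Set.sdiff_self_inter])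
    have hsuT : ∀ x ∈ T \ S, s (u x) ∈ T := fun x hx => by
      by_cases hux : u x ∈ S
      · exact (hsI ⟨u x, ⟨hux, x, hx, rfl⟩, rfl⟩).2
      · rw [hs _ hux]
        exact (perm_apply_mem_of_fixes_compl hu (.inr hx.1)).resolve_left hux
    have hfix : ∀ x ∈ T \ S, s (u x) ∈ S → s (u x) ∈ s '' (S ∩ u '' (T \ S)) := fun x hx h => by
      refine ⟨u x, ⟨?_, x, hx, rfl⟩, rfl⟩
      by_contra hux
      exact hux (hs _ hux ▸ h)
    obtain ⟨t, ht, htf⟩ := exists_perm_extending (S := T) (A := (s * u) '' (T \ S))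
      (f := ⇑(s * u)⁻¹) (by rintro _ ⟨x, hx, rfl⟩; exact hsuT x hx) (Equiv.injective _).injOn
      (by rintro _ ⟨x, hx, rfl⟩; simpa using hx.1)
      (hsinf.mono fun x hx => ⟨hx.1.2, by
        rintro ⟨y, hy, rfl⟩
        exact hx.2 (hfix y hy hx.1.1)⟩)
      (hI.mono fun x hx => ⟨hx.2, by
        rintro ⟨_, ⟨y, hy, rfl⟩, rfl⟩
        have : (s * u)⁻¹ ((s * u) y) = y := by simp
        rw [this] at hx
        exact hy.2 hx.1⟩)
    have h1 : t * (s * u) ∈ H := by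
      refine mem_of_fix _ (fun x hx => ?_) fun x hx => ?_
      · rw [Perm.mul_apply, Perm.mul_apply, hu x hx, hs x fun h => hx (.inl h),
          ht x fun h => hx (.inr h)]
      · rw [Perm.mul_apply, htf _ ⟨x, hx, rfl⟩]; simp
    rwa [H.mul_mem_cancel_left (hT t ht), H.mul_mem_cancel_left (hS s hs)] at h1
  intro g hg
  have hcompl : ((S ∪ T) \ g '' (T \ S)).Infinite := by
    refine ((hI.mono Set.inter_subset_left).image g.injective.injOn).mono ?_
    rintro _ ⟨x, hx, rfl⟩
    refine ⟨perm_apply_mem_of_fixes_compl hg (.inl hx), ?_⟩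
    rintro ⟨y, hy, h⟩
    exact hy.2 (g.injective h ▸ hx)
  rw [Set.union_sdiff_distrib, Set.infinite_union] at hcompl
  rcases hcompl with h | h
  · exact key g hg h
  -- Here the room is in `T` only. Pushing `T ∩ g '' (T \ S)` into `S ∩ T` while sparing infinitely
  -- many points of `S ∩ T` creates room in `S`.
  · obtain ⟨t, ht, htI, htinf⟩ := exists_perm_image_subset (A := T ∩ g '' (T \ S))
      Set.inter_subset_left (Set.inter_subset_right (s := S)) hI (by rwa [Set.sdiff_self_inter])
    have h1 : t * g ∈ H := by
      refine key _ (fun x hx => ?_) (htinf.mono fun x hx => ⟨hx.1.1, ?_⟩)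
      · rw [Perm.mul_apply, hg x hx, ht x fun h => hx (.inr h)]
      · rintro ⟨y, hy, rfl⟩
        refine hx.2 ⟨g y, ⟨?_, y, hy, rfl⟩, rfl⟩
        by_contra hgy
        exact hgy (ht _ hgy ▸ hx.1.2)
    rwa [H.mul_mem_cancel_left (hT t ht)] at h1

/-- The sequence of the first `n` values of `r`. -/
def initialSegment (r : ℕ → ℕ) (n : ℕ) : Fin n → ℕ := fun i => r i

/-- The involution that swaps `n` with the sequence of the first `n` values of `r`. -/
def swapInitialSegments (r : ℕ → ℕ) : Perm ((Σ n, Fin n → ℕ) ⊕ ℕ) :=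
  Function.Involutive.toPerm
    (fun x => x.elim (fun w => if w.2 = initialSegment r w.1 then .inr w.1 else .inl w)
      fun n => .inl ⟨n, initialSegment r n⟩) (by
    rintro (⟨n, w⟩ | n)
    · by_cases h : w = initialSegment r n <;> simp [h]
    · simp)

theorem swapInitialSegments_swapInitialSegments (r : ℕ → ℕ) (x : (Σ n, Fin n → ℕ) ⊕ ℕ) :
    swapInitialSegments r (swapInitialSegments r x) = x :=
  Function.Involutive.toPerm_involutive _ x

theorem swapInitialSegments_inl (r : ℕ → ℕ) {n : ℕ} {w : Fin n → ℕ} (h : w ≠ initialSegment r n) :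
    swapInitialSegments r (.inl ⟨n, w⟩) = .inl ⟨n, w⟩ :=
  if_neg h

theorem swapInitialSegments_inl_self (r : ℕ → ℕ) (n : ℕ) :
    swapInitialSegments r (.inl ⟨n, initialSegment r n⟩) = .inr n :=
  if_pos rfl

/-- An almost disjoint family: `S` is labelled by finite sequences and its complement by `ℕ`, and
each branch `r` gives an involution swapping `n` with `r` restricted to `n`. There are uncountably
many branches but countably many cosets, so branches `r ≠ s` share a coset. Their quotient lies in
`H` and sends the restriction of `r` to `n` to the point `n`, as soon as `r` and `s` differ below
`n`. -/
theorem exists_mem_finite_compl_union_image [Countable Ω] {H : Subgroup (Perm Ω)}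
    [Countable (Perm Ω ⧸ H)] {S : Set Ω} (hS : S.Infinite) (hS' : Sᶜ.Infinite) :
    ∃ h ∈ H, (S ∪ h '' S)ᶜ.Finite ∧ (S ∩ h '' S).Infinite := by
  classical
  have := hS.to_subtype
  have := hS'.to_subtype
  have : Infinite (Σ n, Fin n → ℕ) :=
    Infinite.of_injective (fun n => ⟨n, 0⟩) fun m n h => congrArg Sigma.fst h
  obtain ⟨e₁⟩ := nonempty_equiv_of_countable (α := Σ n, Fin n → ℕ) (β := S)
  obtain ⟨e₂⟩ := nonempty_equiv_of_countable (α := ℕ) (β := ↑Sᶜ)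
  let e : (Σ n, Fin n → ℕ) ⊕ ℕ ≃ Ω := (Equiv.sumCongr e₁ e₂).trans (Equiv.Set.sumCompl S)
  have eS : ∀ w, e (.inl w) ∈ S := fun w => (e₁ w).2
  have eS' : ∀ x ∉ S, ∃ n, e (.inr n) = x := fun x hx => by
    obtain ⟨n, hn⟩ := e₂.surjective ⟨x, hx⟩
    exact ⟨n, by simp [e, hn]⟩
  obtain ⟨j, hj⟩ := Countable.exists_injective_nat (Perm Ω ⧸ H)
  have hni : ¬ Function.Injective fun r : ℕ → ℕ =>
      (QuotientGroup.mk (e.permCongr (swapInitialSegments r)) : Perm Ω ⧸ H) := fun h =>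
    Function.cantor_injective _ (hj.comp (h.comp
      (f := fun (A : Set ℕ) (n : ℕ) => if n ∈ A then 1 else 0) fun A B hAB => by
        ext n
        have := congrFun hAB n
        by_cases hA : n ∈ A <;> by_cases hB : n ∈ B <;> simp_all))
  obtain ⟨r, s, hrs, hne⟩ : ∃ r s : ℕ → ℕ, (QuotientGroup.mk (e.permCongr (swapInitialSegments r)) :
      Perm Ω ⧸ H) = QuotientGroup.mk (e.permCongr (swapInitialSegments s)) ∧ r ≠ s := by
    simpa [Function.Injective] using hni
  obtain ⟨m, hm⟩ := Function.ne_iff.1 hne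
  have hh : ∀ x, ((e.permCongr (swapInitialSegments r))⁻¹ * e.permCongr (swapInitialSegments s))
      (e x) = e (swapInitialSegments r (swapInitialSegments s x)) := fun x => by
    rw [Perm.mul_apply, Perm.inv_eq_iff_eq]
    simp [swapInitialSegments_swapInitialSegments]
  refine ⟨_, QuotientGroup.eq.1 hrs, ?_, ?_⟩
  · refine ((Finset.range (m + 1)).finite_toSet.image fun n => e (.inr n)).subset fun x hx => ?_
    rw [Set.mem_compl_iff, Set.mem_union, not_or] at hx
    obtain ⟨n, rfl⟩ := eS' x hx.1
    refine ⟨n, ?_, rfl⟩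
    by_contra hn
    have hn : m < n := by simpa using hn
    refine hx.2 ⟨e (.inl ⟨n, initialSegment r n⟩), eS _, ?_⟩
    rw [hh, swapInitialSegments_inl, swapInitialSegments_inl_self]
    exact fun h => hm (congrFun h ⟨m, hn⟩)
  -- Nonempty initial segments of `r + s + 1` differ from those of `r` and of `s` at index `0`, so
  -- both involutions fix them. Length `n + 1` excludes the empty sequence, which all branches
  -- share.
  · refine (Set.infinite_range_of_injective
      (f := fun n : ℕ => e (.inl ⟨n + 1, initialSegment (fun i => r i + s i + 1) (n + 1)⟩)) fun a b h => ?_).mono ?_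
    · have := congrArg Sigma.fst (Sum.inl_injective (e.injective h))
      simpa using this
    · rintro _ ⟨n, rfl⟩
      refine ⟨eS _, e (.inl ⟨n + 1, initialSegment (fun i => r i + s i + 1) (n + 1)⟩), eS _, ?_⟩
      rw [hh, swapInitialSegments_inl, swapInitialSegments_inl]
      · intro h
        have := congrFun h 0
        simp only [initialSegment] at this
        lia
      · intro h
        have := congrFun h 0
        simp only [initialSegment] at this
        lia

/-- The small index property: a subgroup of countable index contains the pointwise stabilizer of a
finite set `F`, and `F` may be chosen to be preserved by the subgroup. -/
theorem exists_finset_containsPermsOn_compl [Countable Ω] [Infinite Ω] [DecidableEq Ω]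
    (H : Subgroup (Perm Ω)) [Countable (Perm Ω ⧸ H)] :
    ∃ F : Finset Ω, ContainsPermsOn H (F : Set Ω)ᶜ ∧ ∀ h ∈ H, F.image h = F := by
  obtain ⟨S, hS, hS', hgood⟩ := exists_infinite_containsPermsOn H
  obtain ⟨h, hh, hfin, hinf⟩ := exists_mem_finite_compl_union_image (H := H) hS hS'
  classical
  -- `F` is taken of least size. For `k ∈ H` the complement of `k '' F` is good as well, and two
  -- cofinite sets meet in an infinite set, so the complement of `F ∩ k '' F` is good; minimality
  -- gives `k '' F = F`.
  have hex : ∃ n, ∃ F : Finset Ω, F.card = n ∧ ContainsPermsOn H (F : Set Ω)ᶜ :=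
    ⟨_, hfin.toFinset, rfl, by
      rw [Set.Finite.coe_toFinset, compl_compl]
      exact hgood.union (hgood.image hh) hinf⟩
  obtain ⟨F, hF, hgF⟩ := Nat.find_spec hex
  refine ⟨F, hgF, fun k hk => ?_⟩
  have himg : k '' (F : Set Ω)ᶜ = ((F.image k : Finset Ω) : Set Ω)ᶜ := by
    rw [Finset.coe_image, Set.image_compl_eq k.bijective]
  have h1 := hgF.image hk
  rw [himg] at h1
  have h2 := hgF.union h1 (by
    rw [← Set.compl_union, ← Finset.coe_union]
    exact (Finset.finite_toSet _).infinite_compl)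
  rw [← Set.compl_inter, ← Finset.coe_inter] at h2
  have h3 : F.card ≤ (F ∩ F.image k).card := hF ▸ Nat.find_min' hex ⟨_, rfl, h2⟩
  have h4 : F ∩ F.image k = F := Finset.eq_of_subset_of_card_le Finset.inter_subset_left h3
  exact (Finset.eq_of_subset_of_card_le (Finset.inter_eq_left.1 h4) Finset.card_image_le).symm

end Moieties

/-! ### Primitive actions are actions on `k`-subsets. -/

section PrimitiveActions

open Equiv

theorem exists_equivariant_equiv {G X Y : Type*} [Group G] [MulAction G X] [MulAction G Y]
    [MulAction.IsPretransitive G X] [MulAction.IsPretransitive G Y] {x : X} {y : Y}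
    (h : MulAction.stabilizer G x = MulAction.stabilizer G y) :
    ∃ e : X ≃ Y, ∀ (g : G) (z : X), e (g • z) = g • e z := by
  have key : ∀ g k : G, g • x = k • x ↔ g • y = k • y := fun g k => by
    rw [← inv_smul_eq_iff, ← inv_smul_eq_iff, smul_smul, smul_smul, ← MulAction.mem_stabilizer_iff,
      h, MulAction.mem_stabilizer_iff]
  choose r hr using MulAction.exists_smul_eq G x
  have hf : ∀ g : G, r (g • x) • y = g • y := fun g => (key _ _).1 (hr _)
  have hinj : Function.Injective fun z => r z • y := fun a b hab => by
    rw [← hr a, ← hr b]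
    exact (key _ _).2 hab
  have hsurj : Function.Surjective fun z => r z • y := fun b => by
    obtain ⟨g, rfl⟩ := MulAction.exists_smul_eq G y b
    exact ⟨g • x, hf g⟩
  refine ⟨Equiv.ofBijective _ (⟨hinj, hsurj⟩ : Function.Bijective _), fun g z => ?_⟩
  change r (g • z) • y = g • r z • y
  rw [smul_smul, ← hf (g * r z), ← smul_smul, hr]

theorem stabilizer_powersetCard_eq_top_iff {k : ℕ} (F : Set.powersetCard ℕ k) :
    MulAction.stabilizer (Perm ℕ) F = ⊤ ↔ (F : Finset ℕ) = ∅ := by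
  refine ⟨fun h => ?_, fun h => ?_⟩
  · rw [Finset.eq_empty_iff_forall_notMem]
    intro a ha
    obtain ⟨b, hb⟩ := Infinite.exists_notMem_finset (F : Finset ℕ)
    have h1 : swap a b ∈ MulAction.stabilizer (Perm ℕ) F := h ▸ Subgroup.mem_top _
    have h2 := congrArg (fun s : Set.powersetCard ℕ k => (s : Finset ℕ)) h1
    simp only [Set.powersetCard.coe_smul] at h2
    have h3 := Finset.smul_mem_smul_finset (a := swap a b) ha
    rw [h2, Perm.smul_def, swap_apply_left] at h3
    exact hb h3
  · rw [eq_top_iff]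
    intro g _
    rw [MulAction.mem_stabilizer_iff]
    ext1
    simp [h]

theorem exists_equiv_powersetCard_of_isPreprimitive {B : Type*} [Countable B] [Nonempty B]
    (ξ : Perm ℕ →* Perm B) (hξ : MulAction.IsPreprimitive ξ.range B) :
    ∃ (k : ℕ) (e : B ≃ Set.powersetCard ℕ k), ∀ (σ : Perm ℕ) (b : B), e (ξ σ b) = σ • e b := by
  let _ : MulAction (Perm ℕ) B := MulAction.compHom B ξ
  have hprim : MulAction.IsPreprimitive (Perm ℕ) B := by
    let f : B →ₑ[ξ.rangeRestrict] B := { toFun := id, map_smul' := fun _ _ => rfl }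
    exact (MulAction.isPreprimitive_congr ξ.rangeRestrict_surjective (f := f)
      Function.bijective_id).2 hξ
  obtain ⟨b⟩ := ‹Nonempty B›
  have : Countable (Perm ℕ ⧸ MulAction.stabilizer (Perm ℕ) b) :=
    (MulAction.orbitEquivQuotientStabilizer (Perm ℕ) b).symm.injective.countable
  obtain ⟨F, hF, hle⟩ := exists_finset_containsPermsOn_compl (MulAction.stabilizer (Perm ℕ) b)
  let F' : Set.powersetCard ℕ F.card := ⟨F, rfl⟩
  have hle' : MulAction.stabilizer (Perm ℕ) b ≤ MulAction.stabilizer (Perm ℕ) F' := fun h hh => by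
    rw [MulAction.mem_stabilizer_iff]
    ext1
    exact hle h hh
  -- Maximality of the point stabilizer is of use only if the setwise stabilizer of `F` is proper.
  -- Otherwise `F` is empty and `hF` puts every permutation into the stabilizer of `b`.
  have heq : MulAction.stabilizer (Perm ℕ) b = MulAction.stabilizer (Perm ℕ) F' := by
    by_cases htop : MulAction.stabilizer (Perm ℕ) F' = ⊤
    · have hempty : F = ∅ := (stabilizer_powersetCard_eq_top_iff F').1 htop
      rw [htop, eq_top_iff]
      exact fun g _ => hF g fun x hx => by simp [hempty] at hx
    · rcases subsingleton_or_nontrivial B with h | h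
      · refine absurd (top_le_iff.1 (le_trans (fun g _ => ?_) hle')) htop
        exact Subsingleton.elim _ _
      · have := MulAction.IsPreprimitive.isCoatom_stabilizer_of_isPreprimitive (Perm ℕ) b
        exact (((this.le_iff.1 hle').resolve_left htop)).symm
  have := Set.powersetCard.isPretransitive (α := ℕ) (n := F.card)
  obtain ⟨e, he⟩ := exists_equivariant_equiv heq
  exact ⟨_, e, he⟩

theorem isIsomorphicPermGroup_of_equivariant {B : Type*} {k : ℕ} (ξ : Perm ℕ →* Perm B)
    (e : B ≃ Set.powersetCard ℕ k) (he : ∀ (σ : Perm ℕ) (b : B), e (ξ σ b) = σ • e b) :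
    IsIsomorphicPermGroup ξ.range (setwiseSymGroup k) := by
  have hmap : ∀ σ, e.permCongrHom (ξ σ) = MulAction.toPermHom _ _ σ := fun σ => by
    ext1 s
    simpa using he σ (e.symm s)
  have hrange : ξ.range.map e.permCongrHom.toMonoidHom = setwiseSymGroup k := by
    rw [MonoidHom.map_range]
    exact congrArg MonoidHom.range (MonoidHom.ext hmap)
  refine ⟨e, (e.permCongrHom.subgroupMap ξ.range).trans (MulEquiv.subgroupCongr hrange),
    fun g a => ?_⟩
  change e (g.1 a) = e.permCongrHom g.1 (e a)
  simp

end PrimitiveActions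

/-! ### Automorphisms of Johnson graphs. -/

section JohnsonGraph

open Equiv
open scoped Pointwise

variable {m : ℕ}

theorem johnsonGraph_adj_of_subset {A : Finset ℕ} (hA : A.card = m)
    {S T : Set.powersetCard ℕ (m + 1)} (hS : A ⊆ (S : Finset ℕ)) (hT : A ⊆ (T : Finset ℕ))
    (hne : S ≠ T) : (johnsonGraph (m + 1)).Adj S T := by
  change ((S : Finset ℕ) ∩ (T : Finset ℕ)).card + 1 = m + 1
  have h1 := Finset.card_le_card (Finset.subset_inter hS hT)
  have h2 := Finset.card_le_card (Finset.inter_subset_left (s₁ := (S : Finset ℕ)) (s₂ := T))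
  have hS' := Set.powersetCard.card_eq S
  have hT' := Set.powersetCard.card_eq T
  have h3 : ((S : Finset ℕ) ∩ (T : Finset ℕ)).card ≠ m + 1 := fun h => by
    have h4 := Finset.eq_of_subset_of_card_le (Finset.inter_subset_left (s₁ := (S : Finset ℕ))
      (s₂ := T)) (by lia)
    exact hne (Set.powersetCard.eq_iff_subset.2 (Finset.inter_eq_left.1 h4))
  lia

theorem erase_eq_inter_of_johnsonGraph_adj {S T : Set.powersetCard ℕ (m + 1)}
    (h : (johnsonGraph (m + 1)).Adj S T) {x : ℕ} (hxS : x ∈ (S : Finset ℕ))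
    (hxT : x ∉ (T : Finset ℕ)) : (S : Finset ℕ).erase x = (S : Finset ℕ) ∩ (T : Finset ℕ) := by
  change ((S : Finset ℕ) ∩ (T : Finset ℕ)).card + 1 = m + 1 at h
  refine (Finset.eq_of_subset_of_card_le (fun y hy => ?_) ?_).symm
  · rw [Finset.mem_inter] at hy
    exact Finset.mem_erase.2 ⟨fun hyx => hxT (hyx ▸ hy.2), hy.1⟩
  · rw [Finset.card_erase_of_mem hxS, Set.powersetCard.card_eq]
    lia

theorem inter_subset_of_johnsonGraph_adj {S T U : Set.powersetCard ℕ (m + 1)}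
    (hST : (johnsonGraph (m + 1)).Adj S T) (hUS : (johnsonGraph (m + 1)).Adj U S)
    (hUT : (johnsonGraph (m + 1)).Adj U T) {x : ℕ} (hxU : x ∈ (U : Finset ℕ))
    (hxS : x ∉ (S : Finset ℕ)) (hxT : x ∉ (T : Finset ℕ)) :
    (S : Finset ℕ) ∩ (T : Finset ℕ) = (U : Finset ℕ).erase x := by
  have h1 := erase_eq_inter_of_johnsonGraph_adj hUS hxU hxS
  have h2 := erase_eq_inter_of_johnsonGraph_adj hUT hxU hxT
  refine (Finset.eq_of_subset_of_card_le (Finset.subset_inter ?_ ?_) ?_).symm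
  · rw [h1]; exact Finset.inter_subset_right
  · rw [h2]; exact Finset.inter_subset_right
  · change ((S : Finset ℕ) ∩ (T : Finset ℕ)).card + 1 = m + 1 at hST
    rw [Finset.card_erase_of_mem hxU, Set.powersetCard.card_eq]
    lia

/-- The sets that contain the intersection of two adjacent vertices are determined by the graph. -/
theorem inter_subset_iff_johnsonGraph {S T : Set.powersetCard ℕ (m + 1)}
    (hST : (johnsonGraph (m + 1)).Adj S T) (U : Set.powersetCard ℕ (m + 1)) :
    (S : Finset ℕ) ∩ (T : Finset ℕ) ⊆ (U : Finset ℕ) ↔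
      U = S ∨ U = T ∨ ((johnsonGraph (m + 1)).Adj U S ∧ (johnsonGraph (m + 1)).Adj U T ∧
        {V | (johnsonGraph (m + 1)).Adj V S ∧ (johnsonGraph (m + 1)).Adj V T ∧
          (johnsonGraph (m + 1)).Adj V U}.Infinite) := by
  have hA : ((S : Finset ℕ) ∩ (T : Finset ℕ)).card = m := by
    change ((S : Finset ℕ) ∩ (T : Finset ℕ)).card + 1 = m + 1 at hST
    lia
  constructor
  · intro hU
    by_cases hUS : U = S
    · exact .inl hUS
    by_cases hUT : U = T
    · exact .inr (.inl hUT)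
    refine .inr (.inr ⟨johnsonGraph_adj_of_subset hA hU Finset.inter_subset_left hUS,
      johnsonGraph_adj_of_subset hA hU Finset.inter_subset_right hUT, ?_⟩)
    -- Adding to `S ∩ T` any point outside `S ∪ T ∪ U` yields a common neighbour.
    let W : Finset ℕ := (S : Finset ℕ) ∪ T ∪ U
    have hW : ((W : Set ℕ)ᶜ).Infinite := W.finite_toSet.infinite_compl
    have := hW.to_subtype
    have hnot : ∀ x : ↑((W : Set ℕ)ᶜ), (x : ℕ) ∉ (S : Finset ℕ) ∩ (T : Finset ℕ) := fun x hx =>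
      x.2 (Finset.mem_coe.2 (Finset.mem_union_left _ (Finset.mem_union_left _
        (Finset.mem_inter.1 hx).1)))
    let V : ↑((W : Set ℕ)ᶜ) → Set.powersetCard ℕ (m + 1) := fun x =>
      ⟨insert (x : ℕ) ((S : Finset ℕ) ∩ (T : Finset ℕ)), by
        rw [Set.powersetCard.mem_iff, Finset.card_insert_of_notMem (hnot x), hA]⟩
    have hV : ∀ x (Y : Set.powersetCard ℕ (m + 1)), (Y : Finset ℕ) ⊆ W →
        (S : Finset ℕ) ∩ (T : Finset ℕ) ⊆ (Y : Finset ℕ) → (johnsonGraph (m + 1)).Adj (V x) Y :=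
      fun x Y hY hAY => johnsonGraph_adj_of_subset hA (Finset.subset_insert _ _) hAY fun h =>
        x.2 (hY (h ▸ Finset.mem_insert_self _ _))
    refine (Set.infinite_range_of_injective (f := V) fun x y hxy => ?_).mono ?_
    · have h0 : insert (x : ℕ) ((S : Finset ℕ) ∩ (T : Finset ℕ)) =
          insert (y : ℕ) ((S : Finset ℕ) ∩ (T : Finset ℕ)) := congrArg Subtype.val hxy
      have h1 : (x : ℕ) ∈ insert (y : ℕ) ((S : Finset ℕ) ∩ (T : Finset ℕ)) :=
        h0 ▸ Finset.mem_insert_self _ _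
      exact Subtype.ext ((Finset.mem_insert.1 h1).resolve_right (hnot x))
    · rintro _ ⟨x, rfl⟩
      refine ⟨hV x S ?_ Finset.inter_subset_left, hV x T ?_ Finset.inter_subset_right, hV x U ?_ hU⟩
      · exact Finset.subset_union_left.trans Finset.subset_union_left
      · exact Finset.subset_union_right.trans Finset.subset_union_left
      · exact Finset.subset_union_right
  · rintro (rfl | rfl | ⟨hUS, hUT, hinf⟩)
    · exact Finset.inter_subset_left
    · exact Finset.inter_subset_right
    -- If `S ∩ T` is not contained in `U`, all common neighbours `V` lie inside the finite set `S ∪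
    -- T`. A point `x` of `V` outside it would give `S ∩ T = V \ {x}`; then `x ∉ U`, and adjacency
    -- of `V` and `U` would put `V \ {x}` inside `U`.
    · by_contra hAU
      refine hinf (Set.Finite.of_finite_image (f := Subtype.val) (Set.Finite.subset
        (Finset.finite_toSet ((S : Finset ℕ) ∪ (T : Finset ℕ)).powerset) ?_)
        Subtype.val_injective.injOn)
      rintro _ ⟨V, ⟨hVS, hVT, hVU⟩, rfl⟩
      rw [Finset.mem_coe, Finset.mem_powerset]
      intro x hx
      by_contra hxST
      rw [Finset.mem_union, not_or] at hxST
      have h1 := inter_subset_of_johnsonGraph_adj hST hVS hVT hx hxST.1 hxST.2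
      have hxU : x ∉ (U : Finset ℕ) := fun hxU => hAU (by
        rw [inter_subset_of_johnsonGraph_adj hST hUS hUT hxU hxST.1 hxST.2]
        exact Finset.erase_subset _ _)
      have h2 := erase_eq_inter_of_johnsonGraph_adj hVU hx hxU
      exact hAU (h1.trans h2 ▸ Finset.inter_subset_right)

theorem exists_adj_inter_eq (A : Set.powersetCard ℕ m) :
    ∃ S T : Set.powersetCard ℕ (m + 1), (johnsonGraph (m + 1)).Adj S T ∧
      (S : Finset ℕ) ∩ (T : Finset ℕ) = A := by
  obtain ⟨a, ha⟩ := Infinite.exists_notMem_finset (A : Finset ℕ)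
  obtain ⟨b, hb⟩ := Infinite.exists_notMem_finset (insert a (A : Finset ℕ))
  rw [Finset.mem_insert, not_or] at hb
  have hA := Set.powersetCard.card_eq A
  have hab : insert a (A : Finset ℕ) ∩ insert b (A : Finset ℕ) = A := by
    ext x
    simp only [Finset.mem_inter, Finset.mem_insert]
    refine ⟨?_, fun h => ⟨.inr h, .inr h⟩⟩
    rintro ⟨rfl | h, rfl | h'⟩
    · exact absurd rfl hb.1
    · exact h'
    · exact h
    · exact h
  refine ⟨⟨insert a (A : Finset ℕ), ?_⟩, ⟨insert b (A : Finset ℕ), ?_⟩, ?_, hab⟩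
  · rw [Set.powersetCard.mem_iff, Finset.card_insert_of_notMem ha, hA]
  · rw [Set.powersetCard.mem_iff, Finset.card_insert_of_notMem hb.2, hA]
  · change (insert a (A : Finset ℕ) ∩ insert b (A : Finset ℕ)).card + 1 = m + 1
    rw [hab, hA]

theorem subset_of_forall_powersetCard_subset {A A' : Set.powersetCard ℕ m}
    (h : ∀ U : Set.powersetCard ℕ (m + 1), (A : Finset ℕ) ⊆ U → (A' : Finset ℕ) ⊆ U) : A' = A := by
  obtain ⟨S, T, -, hST⟩ := exists_adj_inter_eq A
  rw [Set.powersetCard.eq_iff_subset, ← hST]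
  exact Finset.subset_inter (h S (hST ▸ Finset.inter_subset_left))
    (h T (hST ▸ Finset.inter_subset_right))

/-- An `m`-set is encoded as the intersection of two adjacent vertices. By
`inter_subset_iff_johnsonGraph` the vertices above it are described by the graph alone, so an
automorphism carries them to the vertices above another `m`-set. -/
theorem exists_map_subset_iff {f : Perm (Set.powersetCard ℕ (m + 1))}
    (hf : ∀ S T, (johnsonGraph (m + 1)).Adj (f S) (f T) ↔ (johnsonGraph (m + 1)).Adj S T) :
    ∃ f' : Set.powersetCard ℕ m → Set.powersetCard ℕ m, ∀ A U,
      (f' A : Finset ℕ) ⊆ (f U : Finset ℕ) ↔ (A : Finset ℕ) ⊆ (U : Finset ℕ) := by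
  have key : ∀ A : Set.powersetCard ℕ m, ∃ A' : Set.powersetCard ℕ m, ∀ U,
      (A' : Finset ℕ) ⊆ (f U : Finset ℕ) ↔ (A : Finset ℕ) ⊆ (U : Finset ℕ) := by
    intro A
    obtain ⟨S, T, hST, hA⟩ := exists_adj_inter_eq A
    have hST' := (hf S T).2 hST
    refine ⟨⟨(f S : Finset ℕ) ∩ (f T : Finset ℕ), ?_⟩, fun U => ?_⟩
    · change ((f S : Finset ℕ) ∩ (f T : Finset ℕ)).card + 1 = m + 1 at hST'
      rw [Set.powersetCard.mem_iff]
      lia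
    · rw [← hA, inter_subset_iff_johnsonGraph hST]
      refine (inter_subset_iff_johnsonGraph hST' (f U)).trans ?_
      have himg : {V | (johnsonGraph (m + 1)).Adj V (f S) ∧ (johnsonGraph (m + 1)).Adj V (f T) ∧
          (johnsonGraph (m + 1)).Adj V (f U)} = f '' {V | (johnsonGraph (m + 1)).Adj V S ∧
          (johnsonGraph (m + 1)).Adj V T ∧ (johnsonGraph (m + 1)).Adj V U} := by
        ext V
        obtain ⟨V, rfl⟩ := f.surjective V
        simp only [Set.mem_ofPred_eq, hf, f.injective.mem_set_image]
      rw [himg, Set.infinite_image_iff f.injective.injOn]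
      simp only [hf, f.injective.eq_iff]
  choose f' hf' using key
  exact ⟨f', hf'⟩

/-- Expresses adjacency by containment, so that the map induced on `m`-sets is again a graph
automorphism and induction on `k` applies. -/
theorem johnsonGraph_adj_iff_exists {A A' : Set.powersetCard ℕ m} :
    (johnsonGraph m).Adj A A' ↔ A ≠ A' ∧ ∃ U : Set.powersetCard ℕ (m + 1),
      (A : Finset ℕ) ⊆ (U : Finset ℕ) ∧ (A' : Finset ℕ) ⊆ (U : Finset ℕ) := by
  have hA := Set.powersetCard.card_eq A
  have hA' := Set.powersetCard.card_eq A'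
  have hcard := Finset.card_union_add_card_inter (A : Finset ℕ) (A' : Finset ℕ)
  constructor
  · intro h
    refine ⟨h.ne, ⟨(A : Finset ℕ) ∪ (A' : Finset ℕ), ?_⟩, Finset.subset_union_left,
      Finset.subset_union_right⟩
    change ((A : Finset ℕ) ∩ (A' : Finset ℕ)).card + 1 = m at h
    rw [Set.powersetCard.mem_iff]
    lia
  · rintro ⟨hne, U, hU, hU'⟩
    change ((A : Finset ℕ) ∩ (A' : Finset ℕ)).card + 1 = m
    have h1 := Finset.card_le_card (Finset.union_subset hU hU')
    rw [Set.powersetCard.card_eq] at h1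
    have h2 : ((A : Finset ℕ) ∩ (A' : Finset ℕ)).card < (A : Finset ℕ).card := by
      refine Finset.card_lt_card (Finset.inter_subset_left.ssubset_of_ne fun h => hne ?_)
      exact Set.powersetCard.eq_iff_subset.2 (Finset.inter_eq_left.1 h)
    lia

/-- Every automorphism of a Johnson graph is induced by a permutation of `ℕ`. -/
theorem exists_perm_of_johnsonGraph_automorphism : ∀ {k : ℕ} {f : Perm (Set.powersetCard ℕ k)},
    (∀ S T, (johnsonGraph k).Adj (f S) (f T) ↔ (johnsonGraph k).Adj S T) →
      ∃ σ : Perm ℕ, ∀ S, f S = σ • S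
  | 0, f, _ => ⟨1, fun S => by
      ext1
      rw [Finset.card_eq_zero.1 (Set.powersetCard.card_eq (f S)),
        Finset.card_eq_zero.1 (Set.powersetCard.card_eq ((1 : Perm ℕ) • S))]⟩
  | 1, f, _ => by
      refine ⟨Set.powersetCard.ofSingleton.symm.permCongr f, fun S => ?_⟩
      obtain ⟨x, rfl⟩ := Set.powersetCard.ofSingleton.surjective S
      obtain ⟨y, hy⟩ := Set.powersetCard.ofSingleton.surjective (f (Set.powersetCard.ofSingleton x))
      rw [← hy]
      ext1
      have h1 : (Set.powersetCard.ofSingleton.symm.permCongr f) x = y := by simp [← hy]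
      change ({y} : Finset ℕ) = Set.powersetCard.ofSingleton.symm.permCongr f • ({x} : Finset ℕ)
      rw [Finset.smul_finset_singleton, Perm.smul_def, h1]
  -- Each `x ∈ S` lies in some `(m + 1)`-subset `A` of `S`, and `σ • A = f' A ⊆ f S`; hence `σ • S ⊆
  -- f S`, with equality by cardinality. The descent stops at `1`, as `0`-subsets cover no points.
  | m + 2, f, hf => by
      have hf_inv : ∀ S T, (johnsonGraph (m + 2)).Adj (f⁻¹ S) (f⁻¹ T) ↔
          (johnsonGraph (m + 2)).Adj S T := fun S T => by
        rw [← hf]; simp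
      obtain ⟨f', hf'⟩ := exists_map_subset_iff hf
      obtain ⟨g', hg'⟩ := exists_map_subset_iff hf_inv
      have hgf : ∀ A, g' (f' A) = A := fun A => subset_of_forall_powersetCard_subset fun U hU => by
        have := (hg' (f' A) (f U)).2 ((hf' A U).2 hU)
        simpa using this
      have hfg : ∀ A, f' (g' A) = A := fun A => subset_of_forall_powersetCard_subset fun U hU => by
        have := (hf' (g' A) (f⁻¹ U)).2 ((hg' A U).2 hU)
        simpa using this
      obtain ⟨σ, hσ⟩ := exists_perm_of_johnsonGraph_automorphism (f := ⟨f', g', hgf, hfg⟩)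
        fun A A' => by
          rw [johnsonGraph_adj_iff_exists, johnsonGraph_adj_iff_exists, f.surjective.exists]
          refine and_congr (Equiv.injective _).ne_iff (exists_congr fun U => ?_)
          exact and_congr (hf' A U) (hf' A' U)
      refine ⟨σ, fun S => ?_⟩
      symm
      rw [Set.powersetCard.eq_iff_subset]
      intro y hy
      rw [Set.powersetCard.coe_smul, Finset.mem_smul_finset] at hy
      obtain ⟨x, hx, rfl⟩ := hy
      have hS := Set.powersetCard.card_eq S
      obtain ⟨A, hxA, hAS, hA⟩ := Finset.exists_subsuperset_card_eq (n := m + 1)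
        (Finset.singleton_subset_iff.2 hx) (by simp) (by lia)
      have h1 := (hf' ⟨A, hA⟩ S).2 hAS
      have h2 : f' ⟨A, hA⟩ = σ • ⟨A, hA⟩ := hσ ⟨A, hA⟩
      rw [h2, Set.powersetCard.coe_smul] at h1
      exact h1 (Finset.smul_mem_smul_finset (Finset.singleton_subset_iff.1 hxA))

end JohnsonGraph

/-! ### A Ryll-Nardzewski argument: invariant relations are definable. -/

section Definability

open FirstOrder

variable {L : Language} {M : Type*} [L.Structure M]

variable (L) in
/-- The tuples `a` and `b` belong to the same sets that are definable without parameters. -/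
def SameType {n : ℕ} (a b : Fin n → M) : Prop :=
  ∀ D : Set (Fin n → M), (∅ : Set M).Definable L D → (a ∈ D ↔ b ∈ D)

variable (L) in
/-- The permutation `f` of `M` preserves all sets of tuples that are definable without parameters. -/
def PreservesDefinable (f : Equiv.Perm M) : Prop :=
  ∀ (n : ℕ) (t : Fin n → M), SameType L (f ∘ t) t

theorem preservesDefinable_of_equiv (f : L.Equiv M M) : PreservesDefinable L f.toEquiv := by
  intro n t D hD
  obtain ⟨φ, rfl⟩ := Set.empty_definable_iff.1 hD
  exact Language.StrongHomClass.realize_formula f φ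

theorem SameType.symm {n : ℕ} {a b : Fin n → M} (h : SameType L a b) : SameType L b a :=
  fun D hD => (h D hD).symm

theorem SameType.comp {m n : ℕ} {a b : Fin n → M} (h : SameType L a b) (j : Fin m → Fin n) :
    SameType L (a ∘ j) (b ∘ j) :=
  fun _ hD => h _ (hD.preimage_comp j)

variable (L M) in
/-- Up to permutations preserving the definable sets there are finitely many tuples of each length. -/
def FinitelyManyOrbits : Prop :=
  ∀ n : ℕ, ∃ C : Set (Fin n → M), C.Finite ∧
    ∀ t : Fin n → M, ∃ f : Equiv.Perm M, PreservesDefinable L f ∧ f ∘ t ∈ C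

/-- A definable set is a union of orbits, hence determined by its trace on the finite set `C` of
representatives. -/
theorem FinitelyManyOrbits.finite_setOf_definable (h : FinitelyManyOrbits L M) (n : ℕ) :
    {D : Set (Fin n → M) | (∅ : Set M).Definable L D}.Finite := by
  obtain ⟨C, hC, hCt⟩ := h n
  refine Set.Finite.of_finite_image (f := fun D => D ∩ C)
    (hC.finite_subsets.subset ?_) fun D hD E hE hDE => ?_
  · rintro _ ⟨D, -, rfl⟩
    exact Set.inter_subset_right
  · ext t
    obtain ⟨f, hf, hfC⟩ := hCt t
    rw [← hf n t D hD, ← hf n t E hE]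
    have := Set.ext_iff.1 hDE (f ∘ t)
    simpa [hfC] using this

/-- Types are isolated: the finitely many definable sets containing `t` have a definable
intersection. -/
theorem FinitelyManyOrbits.exists_definable_minimal (h : FinitelyManyOrbits L M) {n : ℕ}
    (t : Fin n → M) : ∃ D : Set (Fin n → M), (∅ : Set M).Definable L D ∧ t ∈ D ∧
      ∀ s ∈ D, SameType L t s := by
  have hfin := (h.finite_setOf_definable n).subset
    (t := {D : Set (Fin n → M) | (∅ : Set M).Definable L D ∧ t ∈ D}) fun D hD => hD.1
  have := hfin.to_subtype
  refine ⟨⋂ D : {D : Set (Fin n → M) | (∅ : Set M).Definable L D ∧ t ∈ D}, D,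
    Set.definable_iInter_of_finite fun D => D.2.1, Set.mem_iInter.2 fun D => D.2.2,
    fun s hs D hD => ⟨fun ht => Set.mem_iInter.1 hs ⟨D, hD, ht⟩, fun hsD => ?_⟩⟩
  by_contra ht
  exact Set.mem_iInter.1 hs ⟨Dᶜ, hD.compl, ht⟩ hsD

/-- The projection of the set isolating the type of `(a, c)` is definable and contains `a`, hence
`b`. -/
theorem SameType.exists_snoc (h : FinitelyManyOrbits L M) {n : ℕ} {a b : Fin n → M}
    (hab : SameType L a b) (c : M) :
    ∃ d : M, SameType L (Fin.snoc a c : Fin (n + 1) → M) (Fin.snoc b d) := by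
  obtain ⟨D, hD, hmem, hmin⟩ := h.exists_definable_minimal (Fin.snoc a c : Fin (n + 1) → M)
  have hb := (hab _ (hD.image_comp Fin.castSucc)).1
    ⟨_, hmem, funext fun i => Fin.snoc_castSucc (α := fun _ => M) c a i⟩
  obtain ⟨y, hy, rfl⟩ := hb
  refine ⟨y (Fin.last n), ?_⟩
  have : (Fin.snoc (y ∘ Fin.castSucc) (y (Fin.last n)) : Fin (n + 1) → M) = y :=
    Fin.snoc_init_self y
  change SameType L _ (Fin.snoc (y ∘ Fin.castSucc) (y (Fin.last n)))
  rw [this]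
  exact hmin y hy

theorem SameType.eq_iff {n : ℕ} {a b : Fin n → M} (h : SameType L a b) (i j : Fin n) :
    a i = a j ↔ b i = b j := by
  refine h {v | v i = v j} (Set.empty_definable_iff.2
    ⟨(Language.Term.var i).equal (Language.Term.var j), ?_⟩)
  ext v
  simp [Language.Formula.realize_equal]

variable (L M) in
/-- Finite partial maps, as sets of pairs, that preserve all definable sets. -/
def FinitePartialElementaryMap : Type _ :=
  {s : Set (M × M) // ∃ (n : ℕ) (a b : Fin n → M), SameType L a b ∧
    s = Set.range fun i => (a i, b i)}

instance : Preorder (FinitePartialElementaryMap L M) :=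
  inferInstanceAs (Preorder {_s : Set (M × M) // _})

theorem FinitePartialElementaryMap.sameType (p : FinitePartialElementaryMap L M) {m : ℕ}
    {a b : Fin m → M} (h : ∀ i, (a i, b i) ∈ p.1) : SameType L a b := by
  obtain ⟨n, a', b', hab, hp⟩ := p.2
  rw [hp] at h
  choose j hj using h
  have h1 : a' ∘ j = a := funext fun i => congrArg Prod.fst (hj i)
  have h2 : b' ∘ j = b := funext fun i => congrArg Prod.snd (hj i)
  rw [← h1, ← h2]
  exact hab.comp j

theorem range_subset_range_snoc {n : ℕ} (a b : Fin n → M) (c d : M) :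
    (Set.range fun i => (a i, b i)) ⊆
      Set.range fun i => ((Fin.snoc a c : Fin (n + 1) → M) i, (Fin.snoc b d : Fin (n + 1) → M) i) := by
  rintro _ ⟨i, rfl⟩
  exact ⟨i.castSucc, by simp⟩

theorem FinitePartialElementaryMap.exists_ge_forth (h : FinitelyManyOrbits L M)
    (p : FinitePartialElementaryMap L M) (c : M) :
    ∃ q : FinitePartialElementaryMap L M, (∃ d, (c, d) ∈ q.1) ∧ p ≤ q := by
  obtain ⟨_, n, a, b, hab, rfl⟩ := p
  obtain ⟨d, hd⟩ := hab.exists_snoc h c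
  exact ⟨⟨_, _, _, _, hd, rfl⟩, ⟨d, Fin.last n, by simp⟩, range_subset_range_snoc a b c d⟩

theorem FinitePartialElementaryMap.exists_ge_back (h : FinitelyManyOrbits L M)
    (p : FinitePartialElementaryMap L M) (d : M) :
    ∃ q : FinitePartialElementaryMap L M, (∃ c, (c, d) ∈ q.1) ∧ p ≤ q := by
  obtain ⟨_, n, a, b, hab, rfl⟩ := p
  obtain ⟨c, hc⟩ := hab.symm.exists_snoc h d
  exact ⟨⟨_, _, _, _, hc.symm, rfl⟩, ⟨c, Fin.last n, by simp⟩, range_subset_range_snoc a b c d⟩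

/-- Back and forth: tuples of the same type are conjugate. -/
theorem SameType.exists_perm [Countable M] (h : FinitelyManyOrbits L M) {n : ℕ} {a b : Fin n → M}
    (hab : SameType L a b) : ∃ f : Equiv.Perm M, PreservesDefinable L f ∧ f ∘ a = b := by
  have := Encodable.ofCountable M
  -- One requirement per element: `inl c` puts `c` into the domain, `inr d` puts `d` into the range.
  let 𝒟 : M ⊕ M → Order.Cofinal (FinitePartialElementaryMap L M) := Sum.elim
    (fun c => ⟨{q | ∃ d, (c, d) ∈ q.1}, fun p => p.exists_ge_forth h c⟩)
    (fun d => ⟨{q | ∃ c, (c, d) ∈ q.1}, fun p => p.exists_ge_back h d⟩)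
  let p : FinitePartialElementaryMap L M := ⟨_, n, a, b, hab, rfl⟩
  let s := Order.sequenceOfCofinals p 𝒟
  have hs : Monotone s := Order.sequenceOfCofinals.monotone p 𝒟
  -- Finitely many pairs occur together at one stage of the increasing sequence. For two pairs this
  -- yields that the limit relation is single-valued and injective.
  have hst : ∀ {m : ℕ} {x y : Fin m → M}, (∀ i, ∃ k, (x i, y i) ∈ (s k).1) → SameType L x y := by
    intro m x y hxy
    choose k hk using hxy
    obtain ⟨K, hK⟩ := Finite.exists_le k
    exact (s K).sameType fun i => hs (hK i) (hk i)
  have forth : ∀ c, ∃ d k, (c, d) ∈ (s k).1 := fun c => by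
    obtain ⟨d, hd⟩ := Order.sequenceOfCofinals.encode_mem p 𝒟 (.inl c)
    exact ⟨d, _, hd⟩
  have back : ∀ d, ∃ c k, (c, d) ∈ (s k).1 := fun d => by
    obtain ⟨c, hc⟩ := Order.sequenceOfCofinals.encode_mem p 𝒟 (.inr d)
    exact ⟨c, _, hc⟩
  have heq : ∀ {c d c' d'}, (∃ k, (c, d) ∈ (s k).1) → (∃ k, (c', d') ∈ (s k).1) →
      (c = c' ↔ d = d') := fun {c d c' d'} h₁ h₂ =>
    (hst (x := ![c, c']) (y := ![d, d']) (Fin.forall_fin_two.2 ⟨h₁, h₂⟩)).eq_iff 0 1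
  choose f hf using forth
  choose g hg using back
  refine ⟨⟨f, g, fun c => (heq (hg _) (hf c)).2 rfl, fun d => (heq (hf _) (hg d)).1 rfl⟩,
    fun m t => (hst fun i => hf (t i)).symm, funext fun i => ?_⟩
  exact (heq (hf (a i)) ⟨0, ⟨i, rfl⟩⟩).1 rfl

/-- In a countable structure with finitely many orbits of tuples, the invariant relations are
definable. -/
theorem FinitelyManyOrbits.definable_of_invariant [Countable M] (h : FinitelyManyOrbits L M) {n : ℕ}
    {X : Set (Fin n → M)}
    (hX : ∀ f : Equiv.Perm M, PreservesDefinable L f → ∀ t ∈ X, f ∘ t ∈ X) :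
    (∅ : Set M).Definable L X := by
  have hfin := (h.finite_setOf_definable n).subset
    (t := {D : Set (Fin n → M) | (∅ : Set M).Definable L D ∧ D ⊆ X}) fun D hD => hD.1
  have := hfin.to_subtype
  have hD := Set.definable_iUnion_of_finite (L := L) (A := (∅ : Set M))
    fun D : {D : Set (Fin n → M) | (∅ : Set M).Definable L D ∧ D ⊆ X} => D.2.1
  convert! hD
  refine Set.Subset.antisymm (fun t ht => ?_) (Set.iUnion_subset fun D => D.2.2)
  obtain ⟨D, hD, htD, hmin⟩ := h.exists_definable_minimal t
  refine Set.mem_iUnion.2 ⟨⟨D, hD, fun s hs => ?_⟩, htD⟩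
  obtain ⟨f, hf, rfl⟩ := (hmin s hs).exists_perm h
  exact hX f hf t ht

end Definability

/-! ### Invariant structures on `k`-subsets are reducts of the Johnson graph. -/

section JohnsonReducts

open Equiv FirstOrder
open scoped Pointwise

theorem preservesDefinable_johnson_iff {k : ℕ} (f : Perm (Set.powersetCard ℕ k)) :
    PreservesDefinable Language.graph f ↔ ∃ σ : Perm ℕ, ∀ S, f S = σ • S := by
  constructor
  · intro hf
    refine exists_perm_of_johnsonGraph_automorphism fun S T => ?_
    refine hf 2 ![S, T] {v | (johnsonGraph k).Adj (v 0) (v 1)} (Set.empty_definable_iff.2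
      ⟨Language.adj.formula₂ (Language.Term.var 0) (Language.Term.var 1), ?_⟩)
    ext v
    simp only [Set.mem_ofPred_eq, Language.Formula.realize_rel₂, Language.Term.realize_var]
    rfl
  · rintro ⟨σ, hσ⟩
    have hadj : ∀ S T, (johnsonGraph k).Adj (f S) (f T) ↔ (johnsonGraph k).Adj S T := fun S T => by
      change ((f S : Finset ℕ) ∩ (f T : Finset ℕ)).card + 1 = k ↔ _
      rw [hσ, hσ, Set.powersetCard.coe_smul, Set.powersetCard.coe_smul, ← Finset.smul_finset_inter,
        Finset.card_smul_finset]
      rfl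
    exact preservesDefinable_of_equiv
      { toEquiv := f
        map_fun' := fun g => isEmptyElim g
        map_rel' := fun r x => by
          cases r
          exact hadj (x 0) (x 1) }

theorem finitelyManyOrbits_johnson (k : ℕ) :
    FinitelyManyOrbits Language.graph (Set.powersetCard ℕ k) := by
  intro n
  -- The members of an `n`-tuple of `k`-sets cover at most `n * k` points, and a permutation moves
  -- these into `N`.
  let N := Finset.range (n * k)
  have hfin : {S : Set.powersetCard ℕ k | (S : Finset ℕ) ⊆ N}.Finite :=
    Set.Finite.of_finite_image (f := Subtype.val) (N.powerset.finite_toSet.subset (by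
      rintro _ ⟨S, hS, rfl⟩
      exact Finset.mem_coe.2 (Finset.mem_powerset.2 hS))) Subtype.val_injective.injOn
  refine ⟨{s | ∀ i, (s i : Finset ℕ) ⊆ N}, Set.Finite.pi' fun _ => hfin,
    fun t => ?_⟩
  let U : Finset ℕ := Finset.univ.biUnion fun i => (t i : Finset ℕ)
  have hU : U.card ≤ N.card := by
    refine (Finset.card_biUnion_le_card_mul _ _ k fun i _ => ?_).trans (by simp [N])
    exact (Set.powersetCard.card_eq (t i)).le
  obtain ⟨V, hVN, hV⟩ := Finset.exists_subset_card_eq hU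
  have := Set.powersetCard.isPretransitive (α := ℕ) (n := U.card)
  obtain ⟨σ, hσ⟩ := MulAction.exists_smul_eq (Perm ℕ)
    (⟨U, rfl⟩ : Set.powersetCard ℕ U.card) (⟨V, hV⟩ : Set.powersetCard ℕ U.card)
  have hσ' : σ • U = V := congrArg Subtype.val hσ
  refine ⟨MulAction.toPerm σ, (preservesDefinable_johnson_iff _).2 ⟨σ, fun S => rfl⟩,
    fun i => ?_⟩
  change ((σ • t i : Set.powersetCard ℕ k) : Finset ℕ) ⊆ N
  rw [Set.powersetCard.coe_smul]
  refine (Finset.smul_finset_subset_smul_finset ?_).trans (hσ'.subset.trans hVN)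
  exact Finset.subset_biUnion_of_mem (fun i => (t i : Finset ℕ)) (Finset.mem_univ i)

instance (k : ℕ) : Countable (Set.powersetCard ℕ k) :=
  Subtype.val_injective.countable

theorem definable_johnson_of_invariant {k n : ℕ} {X : Set (Fin n → Set.powersetCard ℕ k)}
    (hX : ∀ σ : Perm ℕ, ∀ t ∈ X, (fun i => σ • t i) ∈ X) :
    (∅ : Set (Set.powersetCard ℕ k)).Definable Language.graph X := by
  refine (finitelyManyOrbits_johnson k).definable_of_invariant fun f hf t ht => ?_
  obtain ⟨σ, hσ⟩ := (preservesDefinable_johnson_iff f).1 hf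
  have : f ∘ t = fun i => σ • t i := funext fun i => hσ (t i)
  exact this ▸ hX σ t ht

theorem isFirstOrderReduct_johnson_of_automorphisms {L : Language} {k : ℕ}
    [L.Structure (Set.powersetCard ℕ k)]
    (h : ∀ σ : Perm ℕ, ∃ f : L.Equiv (Set.powersetCard ℕ k) (Set.powersetCard ℕ k),
      ∀ S, f S = σ • S) :
    IsFirstOrderReduct L Language.graph (Set.powersetCard ℕ k) := by
  refine ⟨fun n R => definable_johnson_of_invariant fun σ t ht => ?_,
    fun n F => definable_johnson_of_invariant fun σ t ht => ?_⟩
  · obtain ⟨f, hf⟩ := h σ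
    have h1 : f ∘ t = fun i => σ • t i := funext fun i => hf (t i)
    rw [← h1]
    exact (f.map_rel R t).2 ht
  · obtain ⟨f, hf⟩ := h σ
    have h1 := f.map_fun F fun i => t i.castSucc
    change Language.Structure.funMap F (fun i : Fin n => t i.castSucc) = t (Fin.last n) at ht
    change Language.Structure.funMap F (fun i : Fin n => σ • t i.castSucc) = σ • t (Fin.last n)
    rw [ht, hf] at h1
    rw [h1]
    exact congrArg _ (funext fun i => (hf (t i.castSucc)).symm)

end JohnsonReducts

theorem mainTheorem10 :
    (∀ ξ : Equiv.Perm ℕ →* Equiv.Perm ℕ, MulAction.IsPreprimitive ξ.range ℕ →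
      ∃ k : ℕ, IsIsomorphicPermGroup ξ.range (setwiseSymGroup k)) ∧
    (∀ (L : FirstOrder.Language.{u, v}) (B : Type w) [L.Structure B] [Countable B] [Nonempty B],
      PreservedByPrimitiveActionOfSym L B →
      ∃ (k : ℕ) (S : L.Structure (Set.powersetCard ℕ k)),
        IsFirstOrderReduct L FirstOrder.Language.graph (Set.powersetCard ℕ k) ∧
        Nonempty (L.Equiv B (Set.powersetCard ℕ k))) := by
  refine ⟨fun ξ hξ => ?_, fun L B _ _ _ ⟨ξ, hξ, haut⟩ => ?_⟩
  · obtain ⟨k, e, he⟩ := exists_equiv_powersetCard_of_isPreprimitive ξ hξ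
    exact ⟨k, isIsomorphicPermGroup_of_equivariant ξ e he⟩
  · obtain ⟨k, e, he⟩ := exists_equiv_powersetCard_of_isPreprimitive ξ hξ
    let S : L.Structure (Set.powersetCard ℕ k) := e.inducedStructure
    let E : L.Equiv B (Set.powersetCard ℕ k) := e.inducedStructureEquiv
    refine ⟨k, S, isFirstOrderReduct_johnson_of_automorphisms fun σ => ?_, ⟨E⟩⟩
    obtain ⟨f, hf⟩ := haut σ
    refine ⟨(E.comp f).comp E.symm, fun s => ?_⟩
    change e (f (e.symm s)) = σ • s
    rw [hf, he, Equiv.apply_symm_apply]
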